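/- **Setting.** An instance $I=(G,k,\phi,\tau)$ of Node Unique Label Cover over a finite alphabet $\Sigma$ consists of a finite simple graph $G$, an integer $k\ge 0$, for every edge $e=uw$ and each endpoint $u$ of $e$ a permutation $\phi_{e,u}$ of $\Sigma$ with $\phi_{e,u}=\phi_{e,w}^{-1}$, and a function $\tau:V(G)\to 2^{\Sigma}$. For $X\subseteq V(G)$, a labeling $\Psi:V(G)\setminus X\to\Sigma$ is *feasible for $G-X$* if $\Psi(w)=\phi_{e,u}(\Psi(u))$ for every edge $e=uw$ of $G-X$, and *consistent with $\tau$* if $\Psi(u)\in\tau(u)$ for all $u\notin X$. A *solution* of $I$ is a set $X\subseteq V(G)$ with $|X|\le k$ such that $G-X$ has a feasible labeling consistent with $\tau$. The auxiliary graph $H_I$ has vertex set $V(G)\times\Sigma$, with $(u,i)$ written $u_i$ (a *copy* of $u$), and $u_i$ is adjacent to $w_j$ iff $e=uw\in E(G)$ and $j=\phi_{e,u}(i)$. For $X\subseteq V(G)$, $[X]$ is the set of all copies of vertices of $X$. A set of vertices of $H_I$ is *regular* if it contains at most one copy of each vertex of $G$. For a vertex $a$ of $H_I$ and a set $T$ of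 vertices of $H_I$, an *$a$–$T$ separator* is a set $S$ of vertices of $H_I$ with $a\notin S$ such that $H_I-S$ contains no path from $a$ to a vertex of $T$ (in particular, $a\notin T$; $S$ may contain vertices of $T$). $R(a,S)$ denotes the vertex set of the component of $H_I-S$ containing $a$. A separator $S$ is *minimum* if it has the smallest size among all $a$–$T$ separators, and it is *good* if $R(a,S)\cup S$ is regular. **Lemma (Persistence Lemma).** Let $X$ be a solution of $I$ and let $\Psi$ be a feasible labeling of $G-X$ consistent with $\tau$. Let $v\in V(G)\setminus X$ and $\alpha\in\Sigma$ with $\tau(v)=\{\alpha\}$, and let $T=\{u_\gamma : u\in V(G),\ \gamma\in\Sigma\setminus\tau(u)\}$. Then: 1. $[X]$ is a $v_\alpha$–$T$ separator in $H_I$. 2. If $S$ is a good minimum $v_\alpha$–$T$ separator in $H_I$, then there is a solution $X'$ of $I$ with $|X'|\le|X|$ that contains no vertex of $G$ having a copy in $R(v_\alpha,S)$. In particular, if $X$ is a solution of minimum size, then so is $X'$. Statement 2 also holds if separators are required in addition to be disjoint from $T$, that is, for every $S$ with $R(v_\alpha,S)\cup S$ regular that has minimum size among the $v_\alpha$–$T$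 separators disjoint from $T$. -/

import Mathlib

/-- An instance `(G, k, φ, τ)` of Node Unique Label Cover on the vertex set `V` over the
alphabet `L`. For an edge `e = uw`, `perm h` with `h : G.Adj u w` is the permutation `φ_{e,u}`. -/
structure NULCInstance (V L : Type*) where
  G : SimpleGraph V
  k : ℕ
  perm : ∀ {u w : V}, G.Adj u w → Equiv.Perm L
  perm_symm : ∀ {u w : V} (h : G.Adj u w), perm h = (perm h.symm)⁻¹
  τ : V → Set L

/-- `R(A, S)`: the vertices of the components of `H - S` that intersect `A`. -/
def reachSet {W : Type*} (H : SimpleGraph W) (A S : Set W) : Set W :=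
  {b | ∃ a ∈ A, ∃ p : H.Walk a b, ∀ x ∈ p.support, x ∉ S}

/-- `S` is disjoint from `A`, and `H - S` has no path from `A` to `B`.
The set `S` is allowed to contain vertices of `B`. -/
def IsSeparator {W : Type*} (H : SimpleGraph W) (A B S : Set W) : Prop :=
  Disjoint S A ∧ ∀ a ∈ A, ∀ b ∈ B, ∀ p : H.Walk a b, ∃ x ∈ p.support, x ∈ S

/-- A separator that is moreover disjoint from the target set `B`. -/
def IsStrictSeparator {W : Type*} (H : SimpleGraph W) (A B S : Set W) : Prop :=
  IsSeparator H A B S ∧ Disjoint S B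

/-- `S` has minimum cardinality among the sets with property `P`. -/
def IsMinimumSet {W : Type*} (P : Set W → Prop) (S : Set W) : Prop :=
  P S ∧ ∀ S', P S' → S.ncard ≤ S'.ncard

namespace NULCInstance

variable {V L : Type*}

/-- `Ψ` is a feasible labeling of `G - X`. -/
def IsFeasible (I : NULCInstance V L) (X : Set V) (Ψ : {u : V // u ∉ X} → L) : Prop :=
  ∀ (u w : {u : V // u ∉ X}) (h : I.G.Adj u.1 w.1), I.perm h (Ψ u) = Ψ w

/-- The labeling `Ψ` of `G - X` is consistent with `τ`. -/
def IsConsistent (I : NULCInstance V L) (X : Set V) (Ψ : {u : V // u ∉ X} → L) : Prop :=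
  ∀ u : {u : V // u ∉ X}, Ψ u ∈ I.τ u.1

/-- `X` is a deletion set witnessing that the instance is a yes-instance: `|X| ≤ k`, and `G - X`
has a feasible labeling consistent with `τ`. -/
def IsSolution (I : NULCInstance V L) (X : Set V) : Prop :=
  X.ncard ≤ I.k ∧ ∃ Ψ : {u : V // u ∉ X} → L, I.IsFeasible X Ψ ∧ I.IsConsistent X Ψ

/-- The auxiliary graph `H_I` on `V × L`; the pair `(u, i)` is the copy `u_i`. -/
def auxGraph (I : NULCInstance V L) : SimpleGraph (V × L) where
  Adj a b := ∃ h : I.G.Adj a.1 b.1, I.perm h a.2 = b.2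
  symm := ⟨by
    rintro a b ⟨h, hab⟩
    refine ⟨h.symm, ?_⟩
    rw [I.perm_symm h.symm, ← hab]
    simp⟩
  loopless := ⟨fun a h => I.G.loopless.irrefl a.1 h.1⟩

/-- `[X]`: all copies of the vertices of `X`. -/
def copies (X : Set V) : Set (V × L) := {a | a.1 ∈ X}

/-- `Z⁻¹`: the vertices of `G` that have a copy in `Z`. -/
def proj (Z : Set (V × L)) : Set V := {u | (copies {u} ∩ Z).Nonempty}

/-- A set of vertices of `H_I` is regular if it has at most one copy of each vertex of `G`. -/
def IsRegular (Z : Set (V × L)) : Prop := ∀ u : V, (Z ∩ copies {u}).encard ≤ 1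

/-- `T`: the copies `u_γ` with `γ ∉ τ(u)`. -/
def forbidden (I : NULCInstance V L) : Set (V × L) := {a | a.2 ∉ I.τ a.1}

/-- `R[A, S] = R(A, S) ∪ S` is regular. -/
def IsGood (I : NULCInstance V L) (A S : Set (V × L)) : Prop :=
  IsRegular (reachSet I.auxGraph A S ∪ S)

end NULCInstance

/-!
Let `R = R(A, S)`. The proof trades parts of `X` and `S` against each other. Call a vertex of `S`
*conflicting* if it is a copy of a vertex outside `X` that carries another label under `Ψ`. Walks
that start at copies chosen by `Ψ` keep to such copies until they meet `[X]`, so they never use a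
conflicting vertex; replacing the conflicting vertices of `S` by `[X] ∩ R` therefore gives a
separator, and minimality of `S` bounds their number by `|[X] ∩ R|`. Conversely, replacing the
vertices of `X` with a copy in `R` by those with a conflicting copy gives a set `X'`, which is no
larger than `X` because `R ∪ S` is regular. Labeling the vertices with a copy in `R` by that copy,
and all others by `Ψ`, is feasible for `G - X'`: an edge that leaves `R` ends in `S`, either at a
deleted vertex or at one where `S` and `Ψ` agree.
-/

section Separator

variable {W : Type*} {H : SimpleGraph W} {A B Q S : Set W}

theorem disjoint_reachSet : Disjoint (reachSet H A S) S := by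
  rw [Set.disjoint_left]
  rintro b ⟨a, -, p, hp⟩
  exact hp b p.end_mem_support

theorem sdiff_subset_reachSet : A \ S ⊆ reachSet H A S := by
  rintro a ⟨ha, haS⟩
  exact ⟨a, ha, .nil, by simpa using haS⟩

theorem mem_reachSet_of_adj {b c : W} (hb : b ∈ reachSet H A S) (hbc : H.Adj b c) (hc : c ∉ S) :
    c ∈ reachSet H A S := by
  obtain ⟨a, ha, p, hp⟩ := hb
  refine ⟨a, ha, p.concat hbc, fun x hx => ?_⟩
  rw [SimpleGraph.Walk.support_concat, List.mem_append, List.mem_singleton] at hx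
  rcases hx with hx | rfl
  · exact hp x hx
  · exact hc

theorem reachSet_subset (hA : A \ S ⊆ Q) (hQ : ∀ b ∈ Q, ∀ c ∉ S, H.Adj b c → c ∈ Q) :
    reachSet H A S ⊆ Q := by
  have end_mem {a b : W} (p : H.Walk a b) (hp : ∀ x ∈ p.support, x ∉ S) (ha : a ∈ Q) : b ∈ Q := by
    induction p with
    | nil => exact ha
    | cons h p ih =>
      rw [SimpleGraph.Walk.support_cons, List.forall_mem_cons] at hp
      exact ih hp.2 (hQ _ ha _ (hp.2 _ p.start_mem_support) h)
  rintro b ⟨a, ha, p, hp⟩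
  exact end_mem p hp (hA ⟨ha, hp a p.start_mem_support⟩)

theorem isSeparator_iff_disjoint_reachSet :
    IsSeparator H A B S ↔ Disjoint S A ∧ Disjoint (reachSet H A S) B := by
  refine and_congr_right fun _ => ?_
  rw [Set.disjoint_left]
  constructor
  · rintro h b ⟨a, ha, p, hp⟩ hb
    obtain ⟨x, hx, hxS⟩ := h a ha b hb p
    exact hp x hx hxS
  · intro h a ha b hb p
    by_contra! hp
    exact h ⟨a, ha, p, hp⟩ hb

theorem IsSeparator.disjoint_reachSet_target (hS : IsSeparator H A B S) :
    Disjoint (reachSet H A S) B :=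
  (isSeparator_iff_disjoint_reachSet.1 hS).2

theorem ncard_le_of_isMinimumSet_separator {S' : Set W}
    (hS : IsMinimumSet (fun S => S.Finite ∧ IsSeparator H A B S) S ∨
      IsMinimumSet (fun S => S.Finite ∧ IsStrictSeparator H A B S) S)
    (hfin : S'.Finite) (hS' : IsSeparator H A B S') (hB : S' ∩ B ⊆ S) : S.ncard ≤ S'.ncard := by
  rcases hS with ⟨-, hmin⟩ | ⟨⟨-, -, hSB⟩, hmin⟩
  · exact hmin S' ⟨hfin, hS'⟩
  · refine hmin S' ⟨hfin, hS', Set.disjoint_left.2 fun x hx hxB => ?_⟩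
    exact Set.disjoint_left.1 hSB (hB ⟨hx, hxB⟩) hxB

theorem IsMinimumSet.of_ncard_le {P : Set W → Prop} {S' : Set W} (hS : IsMinimumSet P S)
    (hS' : P S') (hle : S'.ncard ≤ S.ncard) : IsMinimumSet P S' :=
  ⟨hS', fun Y hY => hle.trans (hS.2 Y hY)⟩

end Separator

namespace NULCInstance

section Regular

variable {V L : Type*} {X : Set V} {Y Z : Set (V × L)}

theorem proj_eq_image_fst (Z : Set (V × L)) : proj Z = Prod.fst '' Z := by
  ext u
  simp [proj, copies, Set.Nonempty, and_comm]

theorem fst_mem_proj {a : V × L} (ha : a ∈ Z) : a.1 ∈ proj Z :=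
  ⟨a, rfl, ha⟩

theorem proj_copies_inter (X : Set V) (Z : Set (V × L)) : proj (copies X ∩ Z) = X ∩ proj Z := by
  simp only [proj_eq_image_fst]
  exact Set.image_preimage_inter Prod.fst Z X

theorem IsRegular.injOn_fst (hZ : IsRegular Z) : Set.InjOn Prod.fst Z :=
  fun a ha b hb hab => Set.encard_le_one_iff.1 (hZ b.1) a b ⟨ha, hab⟩ ⟨hb, rfl⟩

theorem IsRegular.mono (hZ : IsRegular Z) (hYZ : Y ⊆ Z) : IsRegular Y :=
  fun u => (Set.encard_le_encard (Set.inter_subset_inter_left _ hYZ)).trans (hZ u)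

theorem IsRegular.ncard_proj (hZ : IsRegular Z) : (proj Z).ncard = Z.ncard := by
  rw [proj_eq_image_fst, hZ.injOn_fst.ncard_image]

theorem IsRegular.finite_copies_inter (hZ : IsRegular Z) (hX : X.Finite) :
    (copies X ∩ Z).Finite := by
  refine Set.Finite.of_finite_image ?_ (hZ.injOn_fst.mono Set.inter_subset_right)
  rw [← proj_eq_image_fst, proj_copies_inter]
  exact hX.inter_of_left _

theorem IsRegular.disjoint_proj (hYZ : IsRegular (Y ∪ Z)) (h : Disjoint Y Z) :
    Disjoint (proj Y) (proj Z) := by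
  rw [Set.disjoint_iff_inter_eq_empty, proj_eq_image_fst, proj_eq_image_fst,
    ← hYZ.injOn_fst.image_inter Set.subset_union_left Set.subset_union_right, h.inter_eq,
    Set.image_empty]

end Regular

section Labeling

variable {V L : Type*} {I : NULCInstance V L} {X : Set V} {Ψ : {u : V // u ∉ X} → L}

/-- The copies `u_{Ψ(u)}` with `u ∉ X`: the labeling `Ψ` of `G - X` seen as a set of vertices of
`H_I`. -/
def assignedCopies (Ψ : {u : V // u ∉ X} → L) : Set (V × L) :=
  Set.range fun u => (u.1, Ψ u)

theorem eq_of_mem_assignedCopies {a b : V × L} (ha : a ∈ assignedCopies Ψ)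
    (hb : b ∈ assignedCopies Ψ) (h : a.1 = b.1) : a = b := by
  obtain ⟨u, rfl⟩ := ha
  obtain ⟨w, rfl⟩ := hb
  rw [Subtype.ext h]

theorem disjoint_copies_assignedCopies : Disjoint (copies X) (assignedCopies Ψ) := by
  rw [Set.disjoint_right]
  rintro _ ⟨u, rfl⟩
  exact u.2

theorem IsConsistent.mem_assignedCopies (hcons : I.IsConsistent X Ψ) {v : V} (hv : v ∉ X) {α : L}
    (hτ : I.τ v = {α}) : (v, α) ∈ assignedCopies Ψ := by
  have hα : Ψ ⟨v, hv⟩ ∈ ({α} : Set L) := hτ ▸ hcons ⟨v, hv⟩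
  exact ⟨⟨v, hv⟩, congrArg (Prod.mk v) hα⟩

theorem IsConsistent.disjoint_assignedCopies_forbidden (hcons : I.IsConsistent X Ψ) :
    Disjoint (assignedCopies Ψ) I.forbidden := by
  rw [Set.disjoint_left]
  rintro _ ⟨u, rfl⟩
  exact not_not.2 (hcons u)

theorem IsFeasible.mem_assignedCopies_of_adj (hfeas : I.IsFeasible X Ψ) {b c : V × L}
    (hb : b ∈ assignedCopies Ψ) (hc : c ∉ copies X) (hbc : I.auxGraph.Adj b c) :
    c ∈ assignedCopies Ψ := by
  obtain ⟨u, rfl⟩ := hb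
  obtain ⟨huc, hperm⟩ := hbc
  exact ⟨⟨c.1, hc⟩, Prod.ext rfl ((hfeas u ⟨c.1, hc⟩ huc).symm.trans hperm)⟩

theorem IsFeasible.auxGraph_adj (hfeas : I.IsFeasible X Ψ) {a b : V × L}
    (ha : a ∈ assignedCopies Ψ) (hb : b ∈ assignedCopies Ψ) (hab : I.G.Adj a.1 b.1) :
    I.auxGraph.Adj a b := by
  obtain ⟨u, rfl⟩ := ha
  obtain ⟨w, rfl⟩ := hb
  exact ⟨hab, hfeas u w hab⟩

theorem isSeparator_copies (hfeas : I.IsFeasible X Ψ) (hcons : I.IsConsistent X Ψ)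
    {A : Set (V × L)} (hA : A ⊆ assignedCopies Ψ) :
    IsSeparator I.auxGraph A I.forbidden (copies X) := by
  refine isSeparator_iff_disjoint_reachSet.2 ⟨disjoint_copies_assignedCopies.mono_right hA, ?_⟩
  refine hcons.disjoint_assignedCopies_forbidden.mono_left ?_
  exact reachSet_subset (Set.sdiff_subset.trans hA)
    fun b hb c hc hbc => hfeas.mem_assignedCopies_of_adj hb hc hbc

theorem exists_labeling_of_auxGraph_adj {Z : Set (V × L)} (hcover : Xᶜ ⊆ proj Z)
    (hadj : ∀ a ∈ Z, ∀ b ∈ Z, a.1 ∉ X → b.1 ∉ X → I.G.Adj a.1 b.1 → I.auxGraph.Adj a b)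
    (hZ : Disjoint Z I.forbidden) :
    ∃ Ψ : {u : V // u ∉ X} → L, I.IsFeasible X Ψ ∧ I.IsConsistent X Ψ := by
  have hlabel (u : {u : V // u ∉ X}) : ∃ i, (u.1, i) ∈ Z := by
    simpa [proj_eq_image_fst] using hcover u.2
  choose Ψ hΨ using hlabel
  refine ⟨Ψ, fun u w huw => ?_, fun u => not_not.1 (Set.disjoint_left.1 hZ (hΨ u))⟩
  exact (hadj _ (hΨ u) _ (hΨ w) u.2 w.2 huw).2

end Labeling

section Exchange

variable {V L : Type*} {I : NULCInstance V L} {X : Set V} {Ψ : {u : V // u ∉ X} → L}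
  {A S : Set (V × L)}

/-- The vertices `u_i` of `S` with `u ∉ X` and `Ψ(u) ≠ i`: the places where following `S` instead
of `Ψ` would change a label. -/
def conflicts (Ψ : {u : V // u ∉ X} → L) (S : Set (V × L)) : Set (V × L) :=
  S \ (copies X ∪ assignedCopies Ψ)

/-- The separator obtained from `S` by replacing its conflicts with the part of `[X]` inside
`R(A, S)`. -/
def exchangedSeparator (I : NULCInstance V L) (Ψ : {u : V // u ∉ X} → L) (A S : Set (V × L)) :
    Set (V × L) :=
  (S \ conflicts Ψ S) ∪ (copies X ∩ reachSet I.auxGraph A S)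

/-- The deletion set obtained from `X` by replacing the vertices that have a copy in `R(A, S)`
with those that have a conflicting copy in `S`. -/
def exchangedDeletionSet (I : NULCInstance V L) (Ψ : {u : V // u ∉ X} → L) (A S : Set (V × L)) :
    Set V :=
  (X \ proj (reachSet I.auxGraph A S)) ∪ proj (conflicts Ψ S)

theorem conflicts_subset : conflicts Ψ S ⊆ S :=
  Set.sdiff_subset

theorem reachSet_exchangedSeparator_subset (hfeas : I.IsFeasible X Ψ)
    (hA : A ⊆ assignedCopies Ψ) (hSA : Disjoint S A) :
    reachSet I.auxGraph A (exchangedSeparator I Ψ A S) ⊆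
      assignedCopies Ψ ∩ reachSet I.auxGraph A S := by
  refine reachSet_subset (fun a ⟨ha, _⟩ => ⟨hA ha, ?_⟩) ?_
  · exact sdiff_subset_reachSet ⟨ha, Set.disjoint_right.1 hSA ha⟩
  · rintro b ⟨hbΨ, hbR⟩ c hc hbc
    have hcS : c ∉ S := by
      intro hcS
      have hcC : c ∈ conflicts Ψ S := by
        by_contra hcC
        exact hc (Or.inl ⟨hcS, hcC⟩)
      obtain ⟨hcX, hcΨ⟩ := not_or.1 hcC.2
      exact hcΨ (hfeas.mem_assignedCopies_of_adj hbΨ hcX hbc)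
    have hcR : c ∈ reachSet I.auxGraph A S := mem_reachSet_of_adj hbR hbc hcS
    have hcX : c ∉ copies X := fun hcX => hc (Or.inr ⟨hcX, hcR⟩)
    exact ⟨hfeas.mem_assignedCopies_of_adj hbΨ hcX hbc, hcR⟩

theorem isSeparator_exchangedSeparator (hfeas : I.IsFeasible X Ψ) (hA : A ⊆ assignedCopies Ψ)
    {B : Set (V × L)} (hS : IsSeparator I.auxGraph A B S) :
    IsSeparator I.auxGraph A B (exchangedSeparator I Ψ A S) := by
  refine isSeparator_iff_disjoint_reachSet.2 ⟨Set.disjoint_union_left.2 ⟨?_, ?_⟩, ?_⟩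
  · exact hS.1.mono_left Set.sdiff_subset
  · exact disjoint_copies_assignedCopies.mono Set.inter_subset_left hA
  · exact hS.disjoint_reachSet_target.mono_left
      ((reachSet_exchangedSeparator_subset hfeas hA hS.1).trans Set.inter_subset_right)

theorem exchangedSeparator_inter_subset {B : Set (V × L)} (hS : IsSeparator I.auxGraph A B S) :
    exchangedSeparator I Ψ A S ∩ B ⊆ S := by
  rintro a ⟨ha | ha, haB⟩
  · exact ha.1
  · exact absurd haB (Set.disjoint_left.1 hS.disjoint_reachSet_target ha.2)

theorem ncard_conflicts_le (hSfin : S.Finite)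
    (hle : S.ncard ≤ (exchangedSeparator I Ψ A S).ncard) :
    (conflicts Ψ S).ncard ≤ (copies X ∩ reachSet I.auxGraph A S).ncard := by
  have hsplit : (S \ conflicts Ψ S).ncard + (conflicts Ψ S).ncard = S.ncard :=
    Set.ncard_sdiff_add_ncard_of_subset conflicts_subset hSfin
  have hunion : (exchangedSeparator I Ψ A S).ncard ≤
      (S \ conflicts Ψ S).ncard + (copies X ∩ reachSet I.auxGraph A S).ncard :=
    Set.ncard_union_le _ _
  lia

theorem ncard_exchangedDeletionSet_le (hX : X.Finite) (hgood : I.IsGood A S)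
    (hle : (conflicts Ψ S).ncard ≤ (copies X ∩ reachSet I.auxGraph A S).ncard) :
    (exchangedDeletionSet I Ψ A S).ncard ≤ X.ncard := by
  set R := reachSet I.auxGraph A S
  have hC : IsRegular (conflicts Ψ S) :=
    IsRegular.mono hgood (conflicts_subset.trans Set.subset_union_right)
  have hXR : IsRegular (copies X ∩ R) :=
    IsRegular.mono hgood (Set.inter_subset_right.trans Set.subset_union_left)
  calc (exchangedDeletionSet I Ψ A S).ncard
      ≤ (X \ proj R).ncard + (proj (conflicts Ψ S)).ncard := Set.ncard_union_le _ _
    _ = (X \ proj R).ncard + (conflicts Ψ S).ncard := by rw [hC.ncard_proj]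
    _ ≤ (X \ proj R).ncard + (copies X ∩ R).ncard := by gcongr
    _ = (X \ proj R).ncard + (X ∩ proj R).ncard := by rw [← hXR.ncard_proj, proj_copies_inter]
    _ = X.ncard := by rw [add_comm, Set.ncard_inter_add_ncard_sdiff_eq_ncard X _ hX]

theorem finite_exchangedDeletionSet (hX : X.Finite) (hS : S.Finite) :
    (exchangedDeletionSet I Ψ A S).Finite := by
  refine hX.sdiff.union ?_
  rw [proj_eq_image_fst]
  exact (hS.subset conflicts_subset).image _

theorem disjoint_exchangedDeletionSet_proj_reachSet (hgood : I.IsGood A S) :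
    Disjoint (exchangedDeletionSet I Ψ A S) (proj (reachSet I.auxGraph A S)) := by
  refine Set.disjoint_union_left.2 ⟨Set.disjoint_sdiff_left, Disjoint.symm ?_⟩
  exact IsRegular.disjoint_proj (IsRegular.mono hgood (Set.union_subset_union_right _
    conflicts_subset)) (disjoint_reachSet.mono_right conflicts_subset)

/-- The copies chosen by the repaired labeling: those in `R(A, S)`, and the ones assigned by `Ψ` to
vertices that have no copy there. -/
def repairedCopies (I : NULCInstance V L) (Ψ : {u : V // u ∉ X} → L) (A S : Set (V × L)) :
    Set (V × L) :=
  reachSet I.auxGraph A S ∪ (assignedCopies Ψ \ copies (proj (reachSet I.auxGraph A S)))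

theorem compl_exchangedDeletionSet_subset_proj_repairedCopies :
    (exchangedDeletionSet I Ψ A S)ᶜ ⊆ proj (repairedCopies I Ψ A S) := by
  intro u hu
  by_cases huR : u ∈ proj (reachSet I.auxGraph A S)
  · obtain ⟨a, hau, haR⟩ := huR
    exact ⟨a, hau, Or.inl haR⟩
  · have huX : u ∉ X := fun huX => hu (Or.inl ⟨huX, huR⟩)
    exact fst_mem_proj (a := (u, Ψ ⟨u, huX⟩)) (Or.inr ⟨⟨⟨u, huX⟩, rfl⟩, huR⟩)

theorem auxGraph_adj_of_mem_reachSet (hgood : I.IsGood A S) {a b : V × L}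
    (ha : a ∈ reachSet I.auxGraph A S) (hb : b ∈ repairedCopies I Ψ A S)
    (hbD : b.1 ∉ exchangedDeletionSet I Ψ A S) (hab : I.G.Adj a.1 b.1) : I.auxGraph.Adj a b := by
  obtain ⟨c, hac, hcb⟩ : ∃ c, I.auxGraph.Adj a c ∧ c.1 = b.1 :=
    ⟨(b.1, I.perm hab a.2), ⟨hab, rfl⟩, rfl⟩
  suffices c = b from this ▸ hac
  have hcRS : c ∈ reachSet I.auxGraph A S ∪ S := by
    by_cases hcS : c ∈ S
    · exact Or.inr hcS
    · exact Or.inl (mem_reachSet_of_adj ha hac hcS)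
  rcases hb with hbR | ⟨hbΨ, hbR⟩
  · exact IsRegular.injOn_fst hgood hcRS (Or.inl hbR) hcb
  · change b.1 ∉ proj (reachSet I.auxGraph A S) at hbR
    have hbX : b.1 ∉ X := Set.disjoint_right.1 disjoint_copies_assignedCopies hbΨ
    rw [← hcb] at hbD hbR hbX
    have hcS : c ∈ S := hcRS.resolve_left fun hcR => hbR (fst_mem_proj hcR)
    have hcC : c ∉ conflicts Ψ S := fun hcC => hbD (Or.inr (fst_mem_proj hcC))
    have hcΨ : c ∈ assignedCopies Ψ := by
      by_contra hcΨ
      exact hcC ⟨hcS, not_or.2 ⟨hbX, hcΨ⟩⟩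
    exact eq_of_mem_assignedCopies hcΨ hbΨ hcb

theorem exists_labeling_exchangedDeletionSet (hfeas : I.IsFeasible X Ψ)
    (hcons : I.IsConsistent X Ψ) (hS : IsSeparator I.auxGraph A I.forbidden S)
    (hgood : I.IsGood A S) :
    ∃ Ψ' : {u : V // u ∉ exchangedDeletionSet I Ψ A S} → L,
      I.IsFeasible _ Ψ' ∧ I.IsConsistent _ Ψ' := by
  refine exists_labeling_of_auxGraph_adj compl_exchangedDeletionSet_subset_proj_repairedCopies
    (fun a ha b hb haX hbX hab => ?_) (Set.disjoint_union_left.2 ⟨hS.disjoint_reachSet_target,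
      hcons.disjoint_assignedCopies_forbidden.mono_left Set.sdiff_subset⟩)
  by_cases haR : a ∈ reachSet I.auxGraph A S
  · exact auxGraph_adj_of_mem_reachSet hgood haR hb hbX hab
  by_cases hbR : b ∈ reachSet I.auxGraph A S
  · exact (auxGraph_adj_of_mem_reachSet hgood hbR ha haX hab.symm).symm
  · exact hfeas.auxGraph_adj (ha.resolve_left haR).1 (hb.resolve_left hbR).1 hab

end Exchange

end NULCInstance

open NULCInstance in
/-- `Set.ncard` is `0` on infinite sets, so minimality is taken among finite sets. -/
theorem mainTheorem2_general {V L : Type*} (I : NULCInstance V L) {X : Set V} (hX : X.Finite)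
    (hXk : X.ncard ≤ I.k) {Ψ : {u : V // u ∉ X} → L} (hfeas : I.IsFeasible X Ψ)
    (hcons : I.IsConsistent X Ψ) {A : Set (V × L)} (hA : A ⊆ assignedCopies Ψ) :
    IsSeparator I.auxGraph A I.forbidden (copies X) ∧
    ∀ S : Set (V × L),
      (IsMinimumSet (fun S => S.Finite ∧ IsSeparator I.auxGraph A I.forbidden S) S ∨
        IsMinimumSet (fun S => S.Finite ∧ IsStrictSeparator I.auxGraph A I.forbidden S) S) →
      I.IsGood A S →
      ∃ X' : Set V, (X'.Finite ∧ I.IsSolution X') ∧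
        Disjoint X' (proj (reachSet I.auxGraph A S)) ∧
        X'.ncard ≤ X.ncard ∧
        (IsMinimumSet (fun Y => Y.Finite ∧ I.IsSolution Y) X →
          IsMinimumSet (fun Y => Y.Finite ∧ I.IsSolution Y) X') := by
  refine ⟨isSeparator_copies hfeas hcons hA, fun S hmin hgood => ?_⟩
  obtain ⟨hSfin, hS⟩ : S.Finite ∧ IsSeparator I.auxGraph A I.forbidden S :=
    hmin.elim (fun h => h.1) fun h => ⟨h.1.1, h.1.2.1⟩
  have hR : IsRegular (reachSet I.auxGraph A S) := IsRegular.mono hgood Set.subset_union_left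
  have hSle : S.ncard ≤ (exchangedSeparator I Ψ A S).ncard :=
    ncard_le_of_isMinimumSet_separator hmin (hSfin.sdiff.union (hR.finite_copies_inter hX))
      (isSeparator_exchangedSeparator hfeas hA hS) (exchangedSeparator_inter_subset hS)
  have hle : (exchangedDeletionSet I Ψ A S).ncard ≤ X.ncard :=
    ncard_exchangedDeletionSet_le hX hgood (ncard_conflicts_le hSfin hSle)
  have hsol : (exchangedDeletionSet I Ψ A S).Finite ∧ I.IsSolution (exchangedDeletionSet I Ψ A S) :=
    ⟨finite_exchangedDeletionSet hX hSfin, hle.trans hXk,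
      exists_labeling_exchangedDeletionSet hfeas hcons hS hgood⟩
  exact ⟨_, hsol, disjoint_exchangedDeletionSet_proj_reachSet hgood, hle,
    fun hXmin => hXmin.of_ncard_le hsol hle⟩

theorem mainTheorem2 {V L : Type*} [Finite V] [Finite L] (I : NULCInstance V L)
    (X : Set V) (hXk : X.ncard ≤ I.k)
    (Ψ : {u : V // u ∉ X} → L) (hfeas : I.IsFeasible X Ψ) (hcons : I.IsConsistent X Ψ)
    (v : V) (hv : v ∉ X) (α : L) (hτ : I.τ v = {α}) :
    IsSeparator I.auxGraph {(v, α)} I.forbidden (NULCInstance.copies X) ∧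
    ∀ S : Set (V × L),
      (IsMinimumSet (IsSeparator I.auxGraph {(v, α)} I.forbidden) S ∨
        IsMinimumSet (IsStrictSeparator I.auxGraph {(v, α)} I.forbidden) S) →
      I.IsGood {(v, α)} S →
      ∃ X' : Set V, I.IsSolution X' ∧
        Disjoint X' (NULCInstance.proj (reachSet I.auxGraph {(v, α)} S)) ∧
        X'.ncard ≤ X.ncard ∧
        (IsMinimumSet I.IsSolution X → IsMinimumSet I.IsSolution X') := by
  simpa only [Set.toFinite, true_and] using mainTheorem2_general I X.toFinite hXk hfeas hcons
    (Set.singleton_subset_iff.2 (hcons.mem_assignedCopies hv hτ))
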